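/- Let $K$ be a field of characteristic different from $2$, let $m \ge 3$ and $n \ge 5$ be integers, and let $R = K[x_1, \dots, x_{m+n-1}]$. Let $M$ be the $m \times n$ Hankel matrix over $R$ whose entry in row $i$ and column $j$ is $x_{i+j-1}$ ($1 \le i \le m$, $1 \le j \le n$), and let $P_2(M) \subseteq R$ be the ideal generated by the permanents of the $2 \times 2$ submatrices of $M$, where the permanent of $\begin{pmatrix} a & b \\ c & d \end{pmatrix}$ is $ad + bc$. Let $G$ be the following set of polynomials: 1. $x_i x_{i+s+t} + x_{i+s} x_{i+t}$ for integers $1 \le i \le m+n-3$, $1 \le s \le m-1$, $1 \le t \le n-1$ with $3 \le i+s+t \le m+n-1$ (these are exactly the $2 \times 2$ permanents of $M$); 2. $x_i x_{i+1}$ for $3 \le i \le m+n-4$; 3. $x_2^2 x_3$ and $x_{m+n-3} x_{m+n-2}^2$; 4. $x_i^2$ for $3 \le i \le m+n-3$; 5. $x_2^4$ and $x_{m+n-2}^4$. Then $G$ is a Gröbner basis of $P_2(M)$ with respect to the lexicographic monomial order with $x_1 > x_2 > \dots > x_{m+n-1}$; that is, $G$ is a finite subset of $P_2(M)$, and the leading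 terms of the elements of $G$ generate the ideal generated by the leading terms of all elements of $P_2(M)$. -/

import Mathlib

open MvPolynomial

/-- The ideal `P_r(M)` generated by the `r × r` subpermanents of a matrix `M`. -/
def permanentalIdeal {m n : ℕ} {R : Type*} [CommRing R] (r : ℕ)
    (M : Matrix (Fin m) (Fin n) R) : Ideal R :=
  Ideal.span {p | ∃ (rows : Fin r ↪o Fin m) (cols : Fin r ↪o Fin n),
    p = (M.submatrix rows cols).permanent}

/-- The polynomial ring `K[x_1, …, x_{m+n-1}]`. The variables are indexed by `Fin (m + n - 1)`,
so that `x_k` is the variable with index `k - 1`, see `hankelVar`. -/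
abbrev HankelRing (K : Type*) [Field K] (m n : ℕ) : Type _ :=
  MvPolynomial (Fin (m + n - 1)) K

/-- The variable `x_k`, where `1 ≤ k ≤ m + n - 1` (numbered from `1`). -/
noncomputable def hankelVar (K : Type*) [Field K] (m n k : ℕ)
    (h : 1 ≤ k ∧ k ≤ m + n - 1 := by omega) : HankelRing K m n :=
  X ⟨k - 1, by omega⟩

/-- The `m × n` Hankel matrix of variables. With rows and columns numbered from `1`, its entry in
row `i` and column `j` is `x_{i+j-1}`; here `i` and `j` start at `0`, so the entry is
`x_{i+j+1}`. -/
noncomputable def hankelMatrix (K : Type*) [Field K] (m n : ℕ) :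
    Matrix (Fin m) (Fin n) (HankelRing K m n) :=
  fun i j => hankelVar K m n (i.val + j.val + 1)

/-- `G` is a Gröbner basis of the ideal `I` with respect to the monomial order `ord`: a finite
subset of `I` whose leading terms generate the ideal of leading terms of `I`. -/
structure IsGroebnerBasis {σ K : Type*} [Field K] (ord : MonomialOrder σ)
    (I : Ideal (MvPolynomial σ K)) (G : Set (MvPolynomial σ K)) : Prop where
  finite : G.Finite
  subset : G ⊆ (I : Set (MvPolynomial σ K))
  span_leadingTerm : Ideal.span (ord.leadingTerm '' G) =
    Ideal.span (ord.leadingTerm '' (I : Set (MvPolynomial σ K)))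

/-- The set `G`, the union of the following five families. -/
def hankelGroebnerSet (K : Type*) [Field K] (m n : ℕ) (hm : 3 ≤ m) (hn : 5 ≤ n) :
    Set (HankelRing K m n) :=
  {f | ∃ (i s t : ℕ) (_ : 1 ≤ i ∧ i ≤ m + n - 3) (_ : 1 ≤ s ∧ s ≤ m - 1) (_ : 1 ≤ t ∧ t ≤ n - 1)
      (_ : 3 ≤ i + s + t ∧ i + s + t ≤ m + n - 1),
      f = hankelVar K m n i * hankelVar K m n (i + s + t) +
        hankelVar K m n (i + s) * hankelVar K m n (i + t)} ∪
  {f | ∃ (i : ℕ) (_ : 3 ≤ i ∧ i ≤ m + n - 4),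
      f = hankelVar K m n i * hankelVar K m n (i + 1)} ∪
  {hankelVar K m n 2 ^ 2 * hankelVar K m n 3,
    hankelVar K m n (m + n - 3) * hankelVar K m n (m + n - 2) ^ 2} ∪
  {f | ∃ (i : ℕ) (_ : 3 ≤ i ∧ i ≤ m + n - 3), f = hankelVar K m n i ^ 2} ∪
  {hankelVar K m n 2 ^ 4, hankelVar K m n (m + n - 2) ^ 4}

open scoped MonomialOrder

/-! Call a monomial standard if no leading monomial of `G` divides it. Since `G` lies in `P_2(M)`,
division by `G` reduces the claim to this: a nonzero element of `P_2(M)` is never a combination of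
standard monomials.

Put `N = m + n - 1`. The standard monomials are among `x_1^a x_2^b` with `b ≤ 3`, `x_2 x_3`, the
single variables, and the mirror images of these under `x_i ↔ x_{N+1-i}`
(`IsHankelStandard.exists_eq`).

They are detected by the map `x_i ↦ ± u v^(i-1)`, with the minus sign exactly where the exponent of
`v` is 2. The sign kills every permanent of weight at most 3, so the map sends `P_2(M)` into `(v^4)
∩ (u^2)`; the same holds with the variables reversed. Every standard monomial has degree at most 1,
or weight at most 3 in one of the two directions, and it is determined by its degree and weight.
Hence its coefficient in an element supported on standard monomials can be read off from the image,
where it is 0.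

The characteristic enters only in `hankelGroebnerSet_subset`. -/

/-! ### Division criterion and leading monomials -/

theorem IsGroebnerBasis.of_standard_eq_zero {σ K : Type*} [Field K] {ord : MonomialOrder σ}
    {I : Ideal (MvPolynomial σ K)} {G : Set (MvPolynomial σ K)} (hfin : G.Finite)
    (hsub : G ⊆ (I : Set (MvPolynomial σ K))) (hG : ∀ g ∈ G, g ≠ 0)
    (hI : ∀ r ∈ I, (∀ c ∈ r.support, ∀ g ∈ G, ¬ ord.degree g ≤ c) → r = 0) :
    IsGroebnerBasis ord I G := by
  refine ⟨hfin, hsub, le_antisymm (Ideal.span_mono (Set.image_mono hsub)) ?_⟩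
  rw [Ideal.span_le]
  rintro _ ⟨f, hf, rfl⟩
  by_cases hf0 : f = 0
  · simp [hf0]
  suffices ∃ g ∈ G, ord.degree g ≤ ord.degree f by
    obtain ⟨g, hgG, hg⟩ := this
    have hlc : ord.leadingCoeff g ≠ 0 := by simpa using hG g hgG
    have : ord.leadingTerm f =
        monomial (ord.degree f - ord.degree g) (ord.leadingCoeff f / ord.leadingCoeff g) *
          ord.leadingTerm g := by
      rw [MonomialOrder.leadingTerm, MonomialOrder.leadingTerm, monomial_mul,
        tsub_add_cancel_of_le hg, div_mul_cancel₀ _ hlc]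
    rw [this]
    exact Ideal.mul_mem_left _ _ (Ideal.subset_span ⟨g, hgG, rfl⟩)
  obtain ⟨q, r, hfq, hdeg, hr⟩ := ord.div_set (B := G)
    (fun g hg => by simpa [isUnit_iff_ne_zero] using hG g hg) f
  have hlin : Finsupp.linearCombination _ (fun g : G => (g : MvPolynomial σ K)) q ∈ I := by
    rw [Finsupp.linearCombination_apply]
    exact Ideal.sum_mem _ fun g _ => Ideal.mul_mem_left _ _ (hsub g.2)
  have hrI : r ∈ I := by
    rw [← sub_eq_of_eq_add' hfq]
    exact Ideal.sub_mem _ hf hlin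
  -- With remainder 0, the leading monomial of `f` occurs in some `g * q g`. The degree bound from
  -- division makes it the leading monomial of that product.
  rw [hI r hrI hr, add_zero, Finsupp.linearCombination_apply, Finsupp.sum] at hfq
  have hc : coeff (ord.degree f) f ≠ 0 := ord.coeff_degree_ne_zero_iff.mpr hf0
  nth_rw 2 [hfq] at hc
  rw [coeff_sum] at hc
  obtain ⟨g, -, hgc⟩ := Finset.exists_ne_zero_of_sum_ne_zero hc
  rw [smul_eq_mul, mul_comm] at hgc
  have hle := ord.le_degree (mem_support_iff.mpr hgc)
  have heq : ord.degree f = ord.degree ((g : MvPolynomial σ K) * q g) :=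
    ord.toSyn.injective (le_antisymm hle (hdeg g))
  have hne : (g : MvPolynomial σ K) * q g ≠ 0 := fun h => hgc (by simp [h])
  refine ⟨g, g.2, ?_⟩
  rw [heq, ord.degree_mul (left_ne_zero_of_mul hne) (right_ne_zero_of_mul hne)]
  exact le_self_add

theorem Matrix.permanent_fin_two {R : Type*} [CommSemiring R] (M : Matrix (Fin 2) (Fin 2) R) :
    M.permanent = M 0 0 * M 1 1 + M 0 1 * M 1 0 := by
  have h : (Finset.univ : Finset (Equiv.Perm (Fin 2))) = {1, Equiv.swap 0 1} := by decide
  rw [Matrix.permanent, h, Finset.sum_pair (by decide)]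
  simp [mul_comm]

theorem degree_lex_X_mul_X_add_X_mul_X {σ K : Type*} [LinearOrder σ] [WellFoundedGT σ] [Field K]
    {i j k l : σ} (hij : i < j) (hik : i < k) (hil : i < l) :
    (MonomialOrder.lex : MonomialOrder σ).degree (X i * X j + X k * X l : MvPolynomial σ K) =
      Finsupp.single i 1 + Finsupp.single j 1 := by
  have h (p q : σ) : (MonomialOrder.lex : MonomialOrder σ).degree (X p * X q : MvPolynomial σ K) =
      Finsupp.single p 1 + Finsupp.single q 1 := by
    rw [MonomialOrder.degree_mul (X_ne_zero _) (X_ne_zero _), MonomialOrder.degree_X,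
      MonomialOrder.degree_X]
  rw [MonomialOrder.degree_add_of_lt, h]
  rw [h, h, MonomialOrder.lex_lt_iff, Finsupp.Lex.lt_iff]
  refine ⟨i, fun p hp => ?_, ?_⟩
  · simp [hp.ne', (hp.trans hij).ne', (hp.trans hik).ne', (hp.trans hil).ne']
  · simp [hij.ne', hik.ne', hil.ne']

/-! ### The signed weight map -/

/-- The map `x_i ↦ ± u v ^ w i` to `K[u][v]`, with sign `-1` exactly when `w i = 2`. -/
noncomputable def signedWeightHom {σ : Type*} (K : Type*) [Field K] (w : σ → ℕ) :
    MvPolynomial σ K →ₐ[K] Polynomial (Polynomial K) :=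
  aeval fun i => Polynomial.monomial (w i) (Polynomial.monomial 1 (if w i = 2 then -1 else 1))

theorem signedWeightHom_monomial {σ : Type*} {K : Type*} [Field K] (w : σ → ℕ) (c : σ →₀ ℕ)
    (a : K) : signedWeightHom K w (monomial c a) =
      Polynomial.monomial (Finsupp.weight w c) (Polynomial.monomial c.degree
        (a * c.prod fun i e => (if w i = 2 then -1 else 1) ^ e)) := by
  induction c using Finsupp.induction_linear generalizing a with
  | zero => simp [signedWeightHom, Polynomial.algebraMap_apply]
  | add f g hf hg =>
    have : monomial (f + g) a = monomial f a * monomial g (1 : K) := by simp [monomial_mul]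
    rw [this, map_mul, hf, hg, Polynomial.monomial_mul_monomial, Polynomial.monomial_mul_monomial,
      map_add, map_add, Finsupp.prod_add_index' (by simp) (fun i => pow_add _), one_mul, mul_assoc]
  | single i e =>
    rw [signedWeightHom, aeval_monomial]
    simp [Polynomial.monomial_pow, Polynomial.C_mul_monomial,
      Polynomial.algebraMap_apply, Finsupp.weight_single, mul_comm]

/-- If `c` is alone in its bidegree (degree, weight), nothing can cancel it in the image. -/
theorem coeff_signedWeightHom {σ : Type*} {K : Type*} [Field K] (w : σ → ℕ)
    {p : MvPolynomial σ K} {c : σ →₀ ℕ} (hp : ∀ b ∈ p.support, b.degree = c.degree →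
      Finsupp.weight w b = Finsupp.weight w c → b = c) :
    ((signedWeightHom K w p).coeff (Finsupp.weight w c)).coeff c.degree =
      p.coeff c * c.prod fun i e => (if w i = 2 then -1 else 1) ^ e := by
  conv_lhs => rw [p.as_sum]
  simp only [map_sum, Polynomial.finsetSum_coeff, signedWeightHom_monomial,
    Polynomial.coeff_monomial]
  rw [Finset.sum_eq_single c]
  · simp
  · intro b hb hbc
    split_ifs with h
    · rw [Polynomial.coeff_monomial, if_neg fun h' => hbc (hp b hb h' h)]
    · simp
  · intro hc
    simp [notMem_support_iff.mp hc]

theorem coeff_eq_zero_of_signedWeightHom {σ : Type*} {K : Type*} [Field K] (w : σ → ℕ)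
    {p : MvPolynomial σ K} {c : σ →₀ ℕ} (hp : ∀ b ∈ p.support, b.degree = c.degree →
      Finsupp.weight w b = Finsupp.weight w c → b = c)
    (h0 : ((signedWeightHom K w p).coeff (Finsupp.weight w c)).coeff c.degree = 0) :
    p.coeff c = 0 := by
  rw [coeff_signedWeightHom w hp] at h0
  refine (mul_eq_zero.mp h0).resolve_right (Finset.prod_ne_zero_iff.mpr fun i _ => ?_)
  dsimp only
  split_ifs <;> simp

theorem signedWeightHom_X_mul_X_add_X_mul_X {σ : Type*} {K : Type*} [Field K] {w : σ → ℕ}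
    {i j k l : σ} (hs : w i + w j = w k + w l) (hk : w i < w k) (hl : w i < w l) :
    Polynomial.X ^ 4 ∣ signedWeightHom K w (X i * X j + X k * X l) ∧
      Polynomial.C (Polynomial.X ^ 2) ∣ signedWeightHom K w (X i * X j + X k * X l) := by
  have h : signedWeightHom K w (X i * X j + X k * X l) =
      Polynomial.X ^ (w i + w j) * Polynomial.C (Polynomial.X ^ 2) *
        Polynomial.C (Polynomial.C ((if w i = 2 then -1 else 1) * (if w j = 2 then -1 else 1) +
          (if w k = 2 then -1 else 1) * (if w l = 2 then -1 else 1))) := by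
    have hX : (Polynomial.X : Polynomial (Polynomial K)) ^ w k * Polynomial.X ^ w l =
        Polynomial.X ^ w i * Polynomial.X ^ w j := by rw [← pow_add, ← pow_add, hs]
    simp only [signedWeightHom, map_add, map_mul, aeval_X, ← Polynomial.C_mul_X_pow_eq_monomial,
      map_pow, pow_add]
    linear_combination Polynomial.C Polynomial.X ^ 2 *
      Polynomial.C (Polynomial.C (if w k = 2 then -1 else 1)) *
      Polynomial.C (Polynomial.C (if w l = 2 then -1 else 1)) * hX
  refine ⟨?_, h ▸ (dvd_mul_left _ _).mul_right _⟩
  by_cases h4 : 4 ≤ w i + w j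
  · rw [h, mul_assoc]
    exact (pow_dvd_pow _ h4).mul_right _
  · rw [h]
    obtain ⟨hi, h12⟩ : w i = 0 ∧
        (w k = 1 ∧ w l = 1 ∧ w j = 2 ∨ w k = 1 ∧ w l = 2 ∧ w j = 3 ∨
          w k = 2 ∧ w l = 1 ∧ w j = 3) := by omega
    -- In weight 2 or 3, exactly one of the two products contains the variable with the minus sign,
    -- so they cancel.
    rcases h12 with ⟨h1, h2, h3⟩ | ⟨h1, h2, h3⟩ | ⟨h1, h2, h3⟩ <;> simp [hi, h1, h2, h3]

/-! ### Membership of `G` in the permanental ideal -/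

theorem hankel_permanent_mem (K : Type*) [Field K] (m n i s t : ℕ)
    (hi : 1 ≤ i ∧ i + s + t ≤ m + n - 1) (hs : 1 ≤ s ∧ s ≤ m - 1) (ht : 1 ≤ t ∧ t ≤ n - 1) :
    hankelVar K m n i * hankelVar K m n (i + s + t) +
      hankelVar K m n (i + s) * hankelVar K m n (i + t) ∈
        permanentalIdeal 2 (hankelMatrix K m n) := by
  -- The top left corner goes in the first column when the rows suffice; otherwise the lower row is
  -- the last one.
  obtain ⟨a, b, hab, ha, hb⟩ : ∃ a b, a + b + 1 = i ∧ a + s < m ∧ b + t < n := by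
    by_cases h : i + s ≤ m
    · exact ⟨i - 1, 0, by omega, by omega, by omega⟩
    · exact ⟨m - 1 - s, i + s - m, by omega, by omega, by omega⟩
  have hrow : StrictMono ![(⟨a, by omega⟩ : Fin m), ⟨a + s, ha⟩] := by
    rw [Fin.strictMono_iff_lt_succ]
    intro j
    fin_cases j
    simp only [Fin.lt_def]
    simp
    omega
  have hcol : StrictMono ![(⟨b, by omega⟩ : Fin n), ⟨b + t, hb⟩] := by
    rw [Fin.strictMono_iff_lt_succ]
    intro j
    fin_cases j
    simp only [Fin.lt_def]
    simp
    omega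
  refine Ideal.subset_span
    ⟨OrderEmbedding.ofStrictMono _ hrow, OrderEmbedding.ofStrictMono _ hcol, ?_⟩
  subst hab
  rw [Matrix.permanent_fin_two]
  simp only [Matrix.submatrix_apply, OrderEmbedding.coe_ofStrictMono, Matrix.cons_val_zero,
    Matrix.cons_val_one, hankelMatrix, hankelVar]
  rw [mul_comm (X (⟨a + b + 1 + s - 1, _⟩ : Fin (m + n - 1)))]
  congr 4 <;> omega

/-- Applied to three products of two variables with a common index sum, whose pairwise sums are
permanents. -/
theorem Ideal.mem_of_add_mem_of_two_ne_zero {K A : Type*} [Field K] [CommRing A] [Algebra K A]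
    (h2 : (2 : K) ≠ 0) {I : Ideal A} {a b c : A} (hab : a + b ∈ I) (hac : a + c ∈ I)
    (hbc : b + c ∈ I) : c ∈ I := by
  have h : c = algebraMap K A 2⁻¹ * ((a + c) + (b + c) - (a + b)) := by
    have : algebraMap K A 2⁻¹ * 2 = 1 := by
      rw [← map_ofNat (algebraMap K A), ← map_mul, inv_mul_cancel₀ h2, map_one]
    linear_combination -c * this
  rw [h]
  exact I.mul_mem_left _ (I.sub_mem (I.add_mem hac hbc) hab)

theorem hankelVar_sq_mem {K : Type*} [Field K] (h2 : (2 : K) ≠ 0) {m n i : ℕ} (hm : 3 ≤ m)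
    (hn : 5 ≤ n) (hi : 3 ≤ i ∧ i ≤ m + n - 3) :
    hankelVar K m n i ^ 2 ∈ permanentalIdeal 2 (hankelMatrix K m n) := by
  obtain ⟨k, rfl⟩ : ∃ k, i = k + 2 := ⟨i - 2, by omega⟩
  have h1 := hankel_permanent_mem K m n k 1 3 (by omega) (by omega) (by omega)
  have h3 := hankel_permanent_mem K m n k 2 2 (by omega) (by omega) (by omega)
  have h4 := hankel_permanent_mem K m n (k + 1) 1 1 (by omega) (by omega) (by omega)
  rw [pow_two]
  exact Ideal.mem_of_add_mem_of_two_ne_zero h2 h1 h3 h4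

/-- The products are `x_k x_{k+5}`, `x_{k+1} x_{k+4}`, `x_{k+2} x_{k+3}`. The first pair uses
columns at distance 4, hence `n ≥ 5`. -/
theorem hankelVar_mul_succ_mem {K : Type*} [Field K] (h2 : (2 : K) ≠ 0) {m n i : ℕ} (hm : 3 ≤ m)
    (hn : 5 ≤ n) (hi : 3 ≤ i ∧ i ≤ m + n - 4) :
    hankelVar K m n i * hankelVar K m n (i + 1) ∈ permanentalIdeal 2 (hankelMatrix K m n) := by
  obtain ⟨k, rfl⟩ : ∃ k, i = k + 2 := ⟨i - 2, by omega⟩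
  have h1 := hankel_permanent_mem K m n k 1 4 (by omega) (by omega) (by omega)
  have h3 := hankel_permanent_mem K m n k 2 3 (by omega) (by omega) (by omega)
  have h4 := hankel_permanent_mem K m n (k + 1) 1 2 (by omega) (by omega) (by omega)
  exact Ideal.mem_of_add_mem_of_two_ne_zero h2 h1 h3 h4

/-- Modulo the ideal, `x_2^2 = -x_1 x_3`. As `x_3^2` lies in the ideal, so do `x_2^2 x_3` and then
`x_2^4`; the right end is symmetric. -/
theorem hankelGroebnerSet_subset (K : Type*) [Field K] (hK : ringChar K ≠ 2) (m n : ℕ)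
    (hm : 3 ≤ m) (hn : 5 ≤ n) :
    hankelGroebnerSet K m n hm hn ⊆ (permanentalIdeal 2 (hankelMatrix K m n) : Set _) := by
  have h2 : (2 : K) ≠ 0 := Ring.two_ne_zero hK
  have hsq {i : ℕ} (hi : 3 ≤ i ∧ i ≤ m + n - 3) := hankelVar_sq_mem h2 hm hn hi
  have hleft := hankel_permanent_mem K m n 1 1 1 (by omega) (by omega) (by omega)
  have hright := hankel_permanent_mem K m n (m + n - 3) 1 1 (by omega) (by omega) (by omega)
  have e1 : m + n - 3 + 1 = m + n - 2 := by omega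
  simp only [e1, Nat.reduceAdd] at hleft hright
  have hl : hankelVar K m n 2 ^ 2 * hankelVar K m n 3 ∈
      permanentalIdeal 2 (hankelMatrix K m n) := by
    have h := Ideal.sub_mem _ (Ideal.mul_mem_left _ (hankelVar K m n 3) hleft)
      (Ideal.mul_mem_left _ (hankelVar K m n 1) (hsq (i := 3) (by omega)))
    convert h using 1
    ring
  have hr : hankelVar K m n (m + n - 3) * hankelVar K m n (m + n - 2) ^ 2 ∈
      permanentalIdeal 2 (hankelMatrix K m n) := by
    have h := Ideal.sub_mem _ (Ideal.mul_mem_left _ (hankelVar K m n (m + n - 3)) hright)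
      (Ideal.mul_mem_left _ (hankelVar K m n (m + n - 2 + 1)) (hsq (i := m + n - 3) (by omega)))
    convert h using 1
    ring
  rintro f ((((⟨i, s, t, hi, hs, ht, hst, rfl⟩ | ⟨i, hi, rfl⟩) | (rfl | rfl)) | ⟨i, hi, rfl⟩) |
    (rfl | rfl))
  · exact hankel_permanent_mem K m n i s t (by omega) hs ht
  · exact hankelVar_mul_succ_mem h2 hm hn hi
  · exact hl
  · exact hr
  · exact hsq hi
  · have h := Ideal.sub_mem _ (Ideal.mul_mem_left _ (hankelVar K m n 2 ^ 2) hleft)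
      (Ideal.mul_mem_left _ (hankelVar K m n 1) hl)
    rw [SetLike.mem_coe]
    convert h using 1
    ring
  · have h := Ideal.sub_mem _ (Ideal.mul_mem_left _ (hankelVar K m n (m + n - 2) ^ 2) hright)
      (Ideal.mul_mem_left _ (hankelVar K m n (m + n - 2 + 1)) hr)
    rw [SetLike.mem_coe]
    convert h using 1
    ring

theorem hankelGroebnerSet_finite (K : Type*) [Field K] (m n : ℕ) (hm : 3 ≤ m) (hn : 5 ≤ n) :
    (hankelGroebnerSet K m n hm hn).Finite := by
  have h1 := Set.finite_range fun p : Fin (m + n - 1) × Fin (m + n - 1) × Fin (m + n - 1) ×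
    Fin (m + n - 1) => (X p.1 * X p.2.1 + X p.2.2.1 * X p.2.2.2 : HankelRing K m n)
  have h2 := Set.finite_range fun p : Fin (m + n - 1) × Fin (m + n - 1) =>
    (X p.1 * X p.2 : HankelRing K m n)
  refine ((((h1.subset ?_).union (h2.subset ?_)).union (Set.toFinite _)).union
    (h2.subset ?_)).union (Set.toFinite _)
  · rintro _ ⟨i, s, t, hi, hs, ht, hst, rfl⟩
    exact ⟨(_, _, _, _), rfl⟩
  · rintro _ ⟨i, hi, rfl⟩
    exact ⟨(_, _), rfl⟩
  · rintro _ ⟨i, hi, rfl⟩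
    exact ⟨(_, _), (pow_two _).symm⟩

/-! ### Vanishing of low coefficients on the ideal -/

theorem signedWeightHom_coeff_eq_zero_of_mem {K : Type*} [Field K] {m n : ℕ}
    {w : Fin (m + n - 1) → ℕ} (hw : (∀ i, w i = i) ∨ ∀ i, w i = i.rev)
    {p : HankelRing K m n} (hp : p ∈ permanentalIdeal 2 (hankelMatrix K m n)) {d e : ℕ}
    (h : e ≤ 3 ∨ d ≤ 1) : ((signedWeightHom K w p).coeff e).coeff d = 0 := by
  have key : permanentalIdeal 2 (hankelMatrix K m n) ≤
      (Ideal.span {Polynomial.X ^ 4} ⊓ Ideal.span {Polynomial.C (Polynomial.X ^ 2)}).comap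
        (signedWeightHom K w) := by
    rw [permanentalIdeal, Ideal.span_le]
    rintro _ ⟨rows, cols, rfl⟩
    have hr : rows 0 < rows 1 := rows.strictMono (by decide)
    have hc : cols 0 < cols 1 := cols.strictMono (by decide)
    rw [Fin.lt_def] at hr hc
    simp only [SetLike.mem_coe, Ideal.mem_comap, Ideal.mem_inf, Ideal.mem_span_singleton,
      Matrix.permanent_fin_two, Matrix.submatrix_apply, hankelMatrix, hankelVar]
    rcases hw with hw | hw
    · apply signedWeightHom_X_mul_X_add_X_mul_X <;> simp only [hw] <;> omega
    -- Under the reversed weight, the lower right entry is the lightest and must come first.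
    · rw [mul_comm (X _)]
      apply signedWeightHom_X_mul_X_add_X_mul_X <;> simp only [hw, Fin.val_rev] <;> omega
  obtain ⟨h4, h2⟩ := key hp
  simp only [SetLike.mem_coe, Ideal.mem_span_singleton] at h4 h2
  rcases h with h | h
  · rw [Polynomial.X_pow_dvd_iff.mp h4 e (by omega), Polynomial.coeff_zero]
  · exact Polynomial.X_pow_dvd_iff.mp ((Polynomial.C_dvd_iff_dvd_coeff _ _).mp h2 e) d (by omega)

/-! ### Standard monomials -/

/-- The exponents of the monomials that no leading monomial of `hankelGroebnerSet` divides, with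
`N = m + n - 1` variables. -/
structure IsHankelStandard {N : ℕ} (c : Fin N →₀ ℕ) : Prop where
  gap : ∀ i j : Fin N, i.val + 2 ≤ j.val → c i = 0 ∨ c j = 0
  adjacent : ∀ i j : Fin N, 2 ≤ i.val → i.val + 4 ≤ N → j.val = i.val + 1 → c i = 0 ∨ c j = 0
  left : ∀ i j : Fin N, i.val = 1 → j.val = 2 → c i ≤ 1 ∨ c j = 0
  right : ∀ i j : Fin N, i.val + 3 = N → j.val + 2 = N → c i = 0 ∨ c j ≤ 1
  sq : ∀ i : Fin N, 2 ≤ i.val → i.val + 3 ≤ N → c i ≤ 1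
  left_pow : ∀ i : Fin N, i.val = 1 → c i ≤ 3
  right_pow : ∀ i : Fin N, i.val + 2 = N → c i ≤ 3

theorem IsHankelStandard.exists_eq {N : ℕ} (hN : 7 ≤ N) {c : Fin N →₀ ℕ}
    (hc : IsHankelStandard c) :
    ∃ (i a b : ℕ) (h : i + 1 < N),
      c = Finsupp.single ⟨i, by omega⟩ a + Finsupp.single ⟨i + 1, h⟩ b ∧
      (i = 0 ∧ b ≤ 3 ∨ i = 1 ∧ b = 0 ∧ a ≤ 3 ∨ i = 1 ∧ a = 1 ∧ b = 1 ∨ a = 1 ∧ b = 0 ∨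
        i + 3 = N ∧ a = 1 ∧ b = 1 ∨ i + 2 = N ∧ a ≤ 3) := by
  by_cases h0 : c = 0
  · exact ⟨0, 0, 0, by omega, by simp [h0], by omega⟩
  have hex : ∃ k, ∃ h : k < N, c ⟨k, h⟩ ≠ 0 := by
    obtain ⟨k, hk⟩ := Finsupp.ne_iff.mp h0
    exact ⟨k, k.2, hk⟩
  classical
  obtain ⟨k, ⟨hkN, hk⟩, hmin⟩ : ∃ k, (∃ h : k < N, c ⟨k, h⟩ ≠ 0) ∧
      ∀ j : Fin N, j.val < k → c j = 0 :=
    ⟨Nat.find hex, Nat.find_spec hex, fun j hj => by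
      have := Nat.find_min hex hj
      push Not at this
      exact this j.2⟩
  -- With `k` the least index in the support, `gap` leaves only `k` and `k + 1`.
  have hlarge (j : Fin N) (hj : k + 2 ≤ j.val) : c j = 0 :=
    (hc.gap ⟨k, hkN⟩ j hj).resolve_left hk
  by_cases hlast : k + 1 < N
  · refine ⟨k, c ⟨k, hkN⟩, c ⟨k + 1, hlast⟩, hlast, ?_, ?_⟩
    · ext j
      simp only [Finsupp.add_apply, Finsupp.single_apply, Fin.ext_iff]
      rcases lt_trichotomy j.val k with h | h | h
      · rw [hmin j h, if_neg (by omega), if_neg (by omega), add_zero]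
      · obtain rfl : j = ⟨k, hkN⟩ := Fin.ext h
        simp
      · by_cases h' : j.val = k + 1
        · obtain rfl : j = ⟨k + 1, hlast⟩ := Fin.ext h'
          simp
        · rw [hlarge j (by omega), if_neg (by omega), if_neg (by omega), add_zero]
    · have h1 := fun h h' => hc.adjacent ⟨k, hkN⟩ ⟨k + 1, hlast⟩ h h' rfl
      have h2 := fun h => hc.left ⟨k, hkN⟩ ⟨k + 1, hlast⟩ h (congrArg (· + 1) h)
      have h3 := fun h => hc.right ⟨k, hkN⟩ ⟨k + 1, hlast⟩ h h
      have h4 := hc.sq ⟨k, hkN⟩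
      have h5 := hc.sq ⟨k + 1, hlast⟩
      have h6 := hc.left_pow ⟨k, hkN⟩
      have h7 := hc.right_pow ⟨k, hkN⟩
      have h8 := hc.left_pow ⟨k + 1, hlast⟩
      generalize c ⟨k, hkN⟩ = a at hk h1 h2 h3 h4 h6 h7 ⊢
      generalize c ⟨k + 1, hlast⟩ = b at h1 h2 h3 h5 h8 ⊢
      clear hlarge hmin hex h0 hc
      dsimp only at h1 h2 h3 h4 h5 h6 h7 h8
      by_cases k0 : k = 0
      · omega
      by_cases k1 : k = 1
      · clear h1 h3 h4 h7 h8
        omega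
      clear h2 h6 h8
      omega
  -- A power of the last variable is written with exponent 0 on the variable before it.
  · obtain rfl : N = k + 1 := by omega
    refine ⟨k - 1, 0, c ⟨k, hkN⟩, by omega, ?_, by omega⟩
    ext j
    simp only [Finsupp.single_zero, zero_add, Finsupp.single_apply, Fin.ext_iff]
    split_ifs with h
    · congr 1
      ext
      simp only
      omega
    · exact hmin j (by omega)

theorem IsHankelStandard.degree_le_or_weight_le {N : ℕ} (hN : 7 ≤ N) {c : Fin N →₀ ℕ}
    (hc : IsHankelStandard c) :
    c.degree ≤ 1 ∨ Finsupp.weight (fun i : Fin N => i.val) c ≤ 3 ∨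
      Finsupp.weight (fun i : Fin N => i.rev.val) c ≤ 3 := by
  obtain ⟨i, a, b, h, rfl, hi⟩ := hc.exists_eq hN
  simp only [Finsupp.weight_single, smul_eq_mul, map_add, Finsupp.degree_single, Fin.val_rev]
  rcases hi with ⟨rfl, hb⟩ | ⟨rfl, rfl, ha⟩ | ⟨rfl, rfl, rfl⟩ | ⟨rfl, rfl⟩ | ⟨rfl, rfl, rfl⟩ |
    ⟨rfl, ha⟩
  · omega
  · omega
  · omega
  · omega
  · right; right; omega
  · right; right
    simp [show i + 2 - (i + 1) = 1 by omega, ha]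

/-- The weight of the monomial is `i * a + (i + 1) * b = d * i + b`. The last three alternatives
account for the ambiguity in writing a pure power or 1 as a pair of exponents. -/
theorem hankelStandard_exponents_unique {N i a b i' a' b' d : ℕ} (hN : 7 ≤ N)
    (hi : i = 0 ∧ b ≤ 3 ∨ i = 1 ∧ b = 0 ∧ a ≤ 3 ∨ i = 1 ∧ a = 1 ∧ b = 1 ∨ a = 1 ∧ b = 0 ∨
      i + 3 = N ∧ a = 1 ∧ b = 1 ∨ i + 2 = N ∧ a ≤ 3)
    (hi' : i' = 0 ∧ b' ≤ 3 ∨ i' = 1 ∧ b' = 0 ∧ a' ≤ 3 ∨ i' = 1 ∧ a' = 1 ∧ b' = 1 ∨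
      a' = 1 ∧ b' = 0 ∨ i' + 3 = N ∧ a' = 1 ∧ b' = 1 ∨ i' + 2 = N ∧ a' ≤ 3)
    (hd : a + b = d) (hd' : a' + b' = d) (hw : d * i + b = d * i' + b') :
    (i = i' ∧ a = a' ∧ b = b') ∨ (i + 1 = i' ∧ a = 0 ∧ b = a' ∧ b' = 0) ∨
      (i' + 1 = i ∧ a' = 0 ∧ b' = a ∧ b = 0) ∨ (a = 0 ∧ b = 0 ∧ a' = 0 ∧ b' = 0) := by
  obtain rfl | rfl | hd2 : d = 0 ∨ d = 1 ∨ 2 ≤ d := by omega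
  · omega
  · omega
  have hlow {j : ℕ} (hj : 4 ≤ j) : 4 * d ≤ d * j := by
    rw [mul_comm]; exact Nat.mul_le_mul_left d hj
  -- For `d ≥ 2` single variables drop out, and each family fixes `d * j` closely enough for linear
  -- arithmetic to separate the weights.
  have hcases {j u v : ℕ} (hj : j = 0 ∧ v ≤ 3 ∨ j = 1 ∧ v = 0 ∧ u ≤ 3 ∨ j = 1 ∧ u = 1 ∧ v = 1 ∨
      u = 1 ∧ v = 0 ∨ j + 3 = N ∧ u = 1 ∧ v = 1 ∨ j + 2 = N ∧ u ≤ 3) (huv : u + v = d) :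
      (j = 0 ∧ d * j = 0 ∧ v ≤ 3) ∨ (j = 1 ∧ d * j = d ∧ v = 0 ∧ u ≤ 3) ∨
        (j = 1 ∧ d * j = d ∧ u = 1 ∧ v = 1) ∨ (j + 3 = N ∧ d * j = 2 * j ∧ u = 1 ∧ v = 1) ∨
        (j + 2 = N ∧ d * j = d * (N - 2) ∧ u ≤ 3) := by
    rcases hj with ⟨rfl, h⟩ | ⟨rfl, h⟩ | ⟨rfl, h⟩ | h | ⟨hN', rfl, rfl⟩ | ⟨rfl, h⟩
    · simp [h]
    · simp [h]
    · simp [h]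
    · omega
    · subst huv
      omega
    · simp [h]
  have h4 := hlow (show 4 ≤ N - 2 by omega)
  have hd2' : d = 2 → d * (N - 2) = 2 * (N - 2) := fun h => by rw [h]
  have h1 := hcases hi hd
  have h2 := hcases hi' hd'
  clear hcases hi hi' hlow
  generalize d * i = x at *
  generalize d * i' = y at *
  generalize d * (N - 2) = z at *
  rcases h1 with h1 | h1 | h1 | h1 | h1 <;> rcases h2 with h2 | h2 | h2 | h2 | h2 <;>
    first
    | (exfalso; omega)
    | (refine .inl ⟨?_, ?_, ?_⟩ <;> omega)
    | (refine .inr (.inl ⟨?_, ?_, ?_, ?_⟩) <;> omega)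
    | (refine .inr (.inr (.inl ⟨?_, ?_, ?_, ?_⟩)) <;> omega)

theorem IsHankelStandard.eq_of_degree_of_weight {N : ℕ} (hN : 7 ≤ N) {c c' : Fin N →₀ ℕ}
    (hc : IsHankelStandard c) (hc' : IsHankelStandard c') (hd : c.degree = c'.degree)
    (hw : Finsupp.weight (fun i : Fin N => i.val) c = Finsupp.weight (fun i : Fin N => i.val) c') :
    c = c' := by
  obtain ⟨i, a, b, h, rfl, hi⟩ := hc.exists_eq hN
  obtain ⟨i', a', b', h', rfl, hi'⟩ := hc'.exists_eq hN
  simp only [Finsupp.weight_single, smul_eq_mul, map_add, Finsupp.degree_single] at hd hw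
  obtain ⟨d, hab⟩ : ∃ d, a + b = d := ⟨_, rfl⟩
  have hw' : d * i + b = d * i' + b' := by
    rw [← hab]
    nth_rw 2 [hd]
    linarith
  have key := hankelStandard_exponents_unique hN hi hi' hab (hd ▸ hab) hw'
  ext k
  simp only [Finsupp.add_apply, Finsupp.single_apply, Fin.ext_iff]
  split_ifs <;> omega

/-! ### Monomials avoiding the leading monomials of `G` -/

theorem hankelVar_eq_X {K : Type*} [Field K] {m n k : ℕ} (h : 1 ≤ k ∧ k ≤ m + n - 1)
    (i : Fin (m + n - 1)) (hk : k = i.val + 1) : hankelVar K m n k h = X i := by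
  subst hk
  rfl

theorem Finsupp.single_add_single_le {σ : Type*} {c : σ →₀ ℕ} {i j : σ} (hij : i ≠ j) {a b : ℕ}
    (ha : a ≤ c i) (hb : b ≤ c j) : Finsupp.single i a + Finsupp.single j b ≤ c := by
  classical
  intro k
  rw [Finsupp.add_apply, Finsupp.single_apply, Finsupp.single_apply]
  split_ifs with h1 h2 h2
  · exact absurd (h1.trans h2.symm) hij
  · simpa [← h1] using ha
  · simpa [← h2] using hb
  · simp

theorem hankelGroebnerSet_ne_zero {K : Type*} [Field K] {m n : ℕ} {hm : 3 ≤ m} {hn : 5 ≤ n}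
    {g : HankelRing K m n} (hg : g ∈ hankelGroebnerSet K m n hm hn) : g ≠ 0 := by
  rcases hg with ((((⟨i, s, t, hi, hs, ht, hst, rfl⟩ | ⟨i, hi, rfl⟩) | (rfl | rfl)) |
    ⟨i, hi, rfl⟩) | (rfl | rfl))
  · refine MonomialOrder.ne_zero_of_degree_ne_zero (m := MonomialOrder.lex) ?_
    rw [hankelVar, hankelVar, hankelVar, hankelVar, degree_lex_X_mul_X_add_X_mul_X]
    · simp
    all_goals rw [Fin.mk_lt_mk]; omega
  all_goals simp [hankelVar]

theorem isHankelStandard_of_not_degree_le {K : Type*} [Field K] {m n : ℕ} {hm : 3 ≤ m}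
    {hn : 5 ≤ n} {c : Fin (m + n - 1) →₀ ℕ}
    (hc : ∀ g ∈ hankelGroebnerSet K m n hm hn, ¬ MonomialOrder.lex.degree g ≤ c) :
    IsHankelStandard c := by
  have hmul {i j : Fin (m + n - 1)} (hij : i ≠ j) {a b : ℕ} (ha : a ≤ c i) (hb : b ≤ c j) :
      MonomialOrder.lex.degree (X i ^ a * X j ^ b : HankelRing K m n) ≤ c := by
    rw [MonomialOrder.degree_mul (by simp) (by simp), MonomialOrder.degree_pow,
      MonomialOrder.degree_pow, MonomialOrder.degree_X, MonomialOrder.degree_X]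
    simpa using Finsupp.single_add_single_le hij ha hb
  have hpow {i : Fin (m + n - 1)} {a : ℕ} (ha : a ≤ c i) :
      MonomialOrder.lex.degree (X i ^ a : HankelRing K m n) ≤ c := by
    rw [MonomialOrder.degree_pow, MonomialOrder.degree_X]
    simpa using ha
  have hne {i j : Fin (m + n - 1)} (h : i.val ≠ j.val) : i ≠ j := fun h' => h (congrArg _ h')
  refine ⟨fun i j hij => ?_, fun i j hi hi' hij => ?_, fun i j hi hj => ?_, fun i j hi hj => ?_,
    fun i hi hi' => ?_, fun i hi => ?_, fun i hi => ?_⟩ <;> by_contra! h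
  · have hj := j.2
    -- Any index gap from 2 to `m + n - 2` splits into a row step and a column step.
    obtain ⟨s, t, hs, ht, hst⟩ : ∃ s t, (1 ≤ s ∧ s ≤ m - 1) ∧ (1 ≤ t ∧ t ≤ n - 1) ∧
        i.val + s + t = j.val := by
      by_cases hu : j.val - i.val ≤ m
      · exact ⟨j.val - i.val - 1, 1, by omega, by omega, by omega⟩
      · exact ⟨m - 1, j.val - i.val - (m - 1), by omega, by omega, by omega⟩
    refine hc _ (.inl (.inl (.inl (.inl ⟨i.val + 1, s, t, by omega, hs, ht, by omega, rfl⟩)))) ?_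
    rw [hankelVar_eq_X _ i rfl, hankelVar_eq_X _ j (by omega), hankelVar, hankelVar,
      degree_lex_X_mul_X_add_X_mul_X]
    · exact Finsupp.single_add_single_le (hne (by omega)) (by omega) (by omega)
    all_goals simp only [Fin.lt_def]; omega
  · refine hc _ (.inl (.inl (.inl (.inr ⟨i.val + 1, by omega, rfl⟩)))) ?_
    rw [hankelVar_eq_X _ i rfl, hankelVar_eq_X _ j (by omega)]
    simpa using hmul (hne (i := i) (j := j) (by omega)) (a := 1) (b := 1) (by omega) (by omega)
  · refine hc _ (.inl (.inl (.inr (.inl rfl)))) ?_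
    rw [hankelVar_eq_X _ i (by omega), hankelVar_eq_X _ j (by omega)]
    simpa using hmul (hne (i := i) (j := j) (by omega)) (a := 2) (b := 1) (by omega) (by omega)
  · refine hc _ (.inl (.inl (.inr (.inr rfl)))) ?_
    rw [hankelVar_eq_X _ i (by omega), hankelVar_eq_X _ j (by omega)]
    simpa using hmul (hne (i := i) (j := j) (by omega)) (a := 1) (b := 2) (by omega) (by omega)
  · refine hc _ (.inl (.inr ⟨i.val + 1, by omega, rfl⟩)) ?_
    rw [hankelVar_eq_X _ i rfl]
    exact hpow (by omega)
  · refine hc _ (.inr (.inl rfl)) ?_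
    rw [hankelVar_eq_X _ i (by omega)]
    exact hpow (by omega)
  · refine hc _ (.inr (.inr rfl)) ?_
    rw [hankelVar_eq_X _ i (by omega)]
    exact hpow (by omega)

/-- In a fixed degree the two weights determine each other, so uniqueness for one transfers to the
other. -/
theorem Finsupp.weight_val_add_weight_rev {N : ℕ} (c : Fin N →₀ ℕ) :
    Finsupp.weight (fun i : Fin N => i.val) c + Finsupp.weight (fun i : Fin N => i.rev.val) c =
      c.degree * (N - 1) := by
  rw [Finsupp.weight_eq_sum, Finsupp.weight_eq_sum, Finsupp.degree_eq_sum, Finset.sum_mul,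
    ← Finset.sum_add_distrib]
  refine Finset.sum_congr rfl fun i _ => ?_
  rw [smul_eq_mul, smul_eq_mul, ← mul_add, Fin.val_rev]
  congr 1
  omega

/-! ### Independence of standard monomials modulo the ideal -/

theorem eq_zero_of_mem_permanentalIdeal_of_isHankelStandard {K : Type*} [Field K] {m n : ℕ}
    (hm : 3 ≤ m) (hn : 5 ≤ n) {p : HankelRing K m n}
    (hp : p ∈ permanentalIdeal 2 (hankelMatrix K m n))
    (hstd : ∀ c ∈ p.support, IsHankelStandard c) : p = 0 := by
  have hN : 7 ≤ m + n - 1 := by omega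
  rw [← support_eq_empty, Finset.eq_empty_iff_forall_notMem]
  intro c hc
  refine mem_support_iff.mp hc ?_
  have hval : ∀ b ∈ p.support, b.degree = c.degree →
      Finsupp.weight (fun i : Fin (m + n - 1) => i.val) b = Finsupp.weight (fun i => i.val) c →
        b = c :=
    fun b hb hd hw => (hstd b hb).eq_of_degree_of_weight hN (hstd c hc) hd hw
  rcases (hstd c hc).degree_le_or_weight_le hN with h | h | h
  · exact coeff_eq_zero_of_signedWeightHom _ hval
      (signedWeightHom_coeff_eq_zero_of_mem (.inl fun _ => rfl) hp (.inr h))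
  · exact coeff_eq_zero_of_signedWeightHom _ hval
      (signedWeightHom_coeff_eq_zero_of_mem (.inl fun _ => rfl) hp (.inl h))
  · have hrev : ∀ b ∈ p.support, b.degree = c.degree →
        Finsupp.weight (fun i : Fin (m + n - 1) => i.rev.val) b =
          Finsupp.weight (fun i : Fin (m + n - 1) => i.rev.val) c → b = c := by
      intro b hb hd hw
      have h1 := Finsupp.weight_val_add_weight_rev b
      have h2 := Finsupp.weight_val_add_weight_rev c
      rw [hd, ← h2, hw] at h1
      exact hval b hb hd (Nat.add_right_cancel h1)
    exact coeff_eq_zero_of_signedWeightHom _ hrev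
      (signedWeightHom_coeff_eq_zero_of_mem (.inr fun _ => rfl) hp (.inl h))

theorem mainTheorem1 (K : Type*) [Field K] (hK : ringChar K ≠ 2) (m n : ℕ)
    (hm : 3 ≤ m) (hn : 5 ≤ n) :
    IsGroebnerBasis (MonomialOrder.lex : MonomialOrder (Fin (m + n - 1)))
      (permanentalIdeal 2 (hankelMatrix K m n)) (hankelGroebnerSet K m n hm hn) :=
  .of_standard_eq_zero (hankelGroebnerSet_finite K m n hm hn)
    (hankelGroebnerSet_subset K hK m n hm hn) (fun _ => hankelGroebnerSet_ne_zero)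
    fun _ hr hstd => eq_zero_of_mem_permanentalIdeal_of_isHankelStandard hm hn hr
      fun c hc => isHankelStandard_of_not_degree_le (hstd c hc)
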